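/- For a real $n\times m$ matrix $A$ with rows $a_1,\dots,a_n\neq 0$ ($m,n\geq 1$) and $x\in\mathbb{R}^m\setminus\{0\}$ let $\theta_i(A,x)=\arccos\frac{a_i\cdot x}{\|a_i\|\,\|x\|}\in[0,\pi]$, $\theta(A,x)=\min_{1\leq i\leq n}\theta_i(A,x)$ and $\theta(A)=\sup_{x\in\mathbb{R}^m\setminus\{0\}}\theta(A,x)$, and let the condition number of $A$ be $\mathscr{C}(A)=|\cos\theta(A)|^{-1}\in[1,\infty]$, with $\mathscr{C}(A)=\infty$ and $\log\mathscr{C}(A)=\infty$ when $\theta(A)=\pi/2$. For all integers $1\leq m\leq n$ let $A^{[m,n]}$ be a uniform random $n\times m$ matrix, i.e. a random matrix whose rows are independent and uniformly distributed on the unit sphere $\mathrm{S}^{m-1}\subset\mathbb{R}^m$. Then for every real exponent $\gamma>0$, $$\limsup_{m\to\infty}\left(\sup_{n\geq 5m}\frac{\mathbf{E}\left[\log\mathscr{C}(A^{[m,n]})\right]}{m^{\gamma}}\right)=0,$$ where the expectations are taken in $[0,\infty]$; that is, when $n\geq 5m$, the expectation $\mathbf{E}[\log\mathscr{C}(A^{[m,n]})]$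 grows more slowly, uniformly in $n$, than any positive power of $m$. -/

import Mathlib

open MeasureTheory ProbabilityTheory Filter
open scoped ENNReal

noncomputable section

namespace LPCondition

/-- The `i`-th row `a_i` of a real `n × m` matrix, as a vector of Euclidean space `ℝ^m`. -/
def rowVec {n m : ℕ} (A : Matrix (Fin n) (Fin m) ℝ) (i : Fin n) : EuclideanSpace ℝ (Fin m) :=
  WithLp.toLp 2 (A i)

/-- `θ(A, x) = min_i θ_i(A, x)`, where `θ_i(A, x) = arccos (a_i ⬝ x / (‖a_i‖ ‖x‖)) ∈ [0, π]` is the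
angle between the `i`-th row and `x`. (For `n ≥ 1` the infimum is over a finite nonempty family,
hence a minimum.) -/
def minAngle {n m : ℕ} (A : Matrix (Fin n) (Fin m) ℝ) (x : EuclideanSpace ℝ (Fin m)) : ℝ :=
  ⨅ i : Fin n, InnerProductGeometry.angle (rowVec A i) x

/-- `θ(A) = sup_{x ≠ 0} θ(A, x)`. (For `m ≥ 1` the family is nonempty, and it is bounded
by `π`.) -/
def maxMinAngle {n m : ℕ} (A : Matrix (Fin n) (Fin m) ℝ) : ℝ :=
  ⨆ x : {x : EuclideanSpace ℝ (Fin m) // x ≠ 0}, minAngle A x.1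

/-- The condition number `𝒞(A) = |cos θ(A)|⁻¹ ∈ [1, ∞]`; it is `∞` when `θ(A) = π / 2`. -/
def condNumber {n m : ℕ} (A : Matrix (Fin n) (Fin m) ℝ) : ℝ≥0∞ :=
  (ENNReal.ofReal |Real.cos (maxMinAngle A)|)⁻¹

/-- `log 𝒞(A) ∈ [0, ∞]`. Since `𝒞(A) ≥ 1`, the extended real logarithm is nonnegative and
nothing is truncated by the conversion to `ℝ≥0∞`. -/
def logCondNumber {n m : ℕ} (A : Matrix (Fin n) (Fin m) ℝ) : ℝ≥0∞ :=
  (ENNReal.log (condNumber A)).toENNReal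

/-- The uniform distribution on the unit sphere of `ℝ^m` (normalised surface measure), as a
measure on `ℝ^m`. It is a probability measure for `m ≥ 1`. -/
def sphereUniform (m : ℕ) : Measure (EuclideanSpace ℝ (Fin m)) :=
  let σ := (volume : Measure (EuclideanSpace ℝ (Fin m))).toSphere
  ((σ Set.univ)⁻¹ • σ).map Subtype.val

/-- `A` is a uniform random `n × m` matrix on the probability space `(Ω, P)`: its rows are
i.i.d. random vectors, each uniformly distributed on the unit sphere of `ℝ^m`. -/
structure IsUniformRandomMatrix {Ω : Type*} [MeasurableSpace Ω] (P : Measure Ω) {n m : ℕ}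
    (A : Ω → Matrix (Fin n) (Fin m) ℝ) : Prop where
  measurable_row : ∀ i, Measurable fun ω => rowVec (A ω) i
  indep_rows : iIndepFun (fun i ω => rowVec (A ω) i) P
  law_row : ∀ i, P.map (fun ω => rowVec (A ω) i) = sphereUniform m

end LPCondition

end

/-! For unit rows, `cos θ(A)` is ρ = min over unit x of max_i a_i·x, and `log 𝒞(A)` is large only
when |ρ| is small. Two small-ball estimates for ρ together give E[log 𝒞(A)] ≤ log(4000m) + 162 for m
≥ 2 and n ≥ 5m, which is o(m^γ) uniformly in n.

Both rest on the structure of a minimiser x: if ρ ≠ 0, then x lies in the span of linearly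
independent rows a_j, j ∈ J, with a_j·x = ρ. - `measure_abs_cos_le`: if |ρ| ≤ ε, some row is within
mε of the span of fewer than m others. A slab estimate and a union bound give n·2^n·4m²ε, good for
the far tail (level 4n and above). - `measure_abs_cos_le_pow`: the rows in J determine x up to a
scalar, and the remaining independent rows each satisfy a_i·x ≤ ε with probability at most 1/2 +
4mε. Summing over |J| ≤ m gives a bound exponentially small in n once ε is of order 1/m and n ≥ 5m.

`lintegral_le_add_tsum_measure` combines them: the level log(4000m), plus 4n times an exponentially
small probability, plus a geometric series. -/

namespace LPCondition

/-! ### Uniform measure of slabs and half-spaces on the sphere -/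

section

open Metric Set

/-- The unit ball of dimension `k` has at most `k + 1` times the volume of that of dimension
`k + 1`. -/
lemma volume_ball_le_mul_volume_ball_succ {k : ℕ} (hk : 1 ≤ k) :
    volume (ball (0 : EuclideanSpace ℝ (Fin k)) 1) ≤
      ENNReal.ofReal (k + 1) * volume (ball (0 : EuclideanSpace ℝ (Fin (k + 1))) 1) := by
  have : Nonempty (Fin k) := ⟨⟨0, hk⟩⟩
  have hk' : (1 : ℝ) ≤ k := by exact_mod_cast hk
  rw [EuclideanSpace.volume_ball, EuclideanSpace.volume_ball]
  simp only [ENNReal.ofReal_one, one_pow, one_mul, Fintype.card_fin]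
  rw [← ENNReal.ofReal_mul (by positivity)]
  apply ENNReal.ofReal_le_ofReal
  -- The right side is Γ(k/2 + 2); k ≥ 1 puts both arguments in [2, ∞), where Γ increases.
  have hG : Real.Gamma (((k + 1 : ℕ) : ℝ) / 2 + 1) ≤ (k / 2 + 1) * Real.Gamma (k / 2 + 1) := by
    rw [← Real.Gamma_add_one (by positivity)]
    apply Real.Gamma_strictMonoOn_Ici.monotoneOn
    · simp only [mem_Ici]; push_cast; linarith
    · simp only [mem_Ici]; linarith
    · push_cast; linarith
  have hπ : 1 ≤ √Real.pi := by
    rw [Real.one_le_sqrt]; linarith [Real.pi_gt_three]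
  have h1 : 0 < Real.Gamma (k / 2 + 1) := Real.Gamma_pos_of_pos (by positivity)
  have h2 : 0 < Real.Gamma (((k + 1 : ℕ) : ℝ) / 2 + 1) := Real.Gamma_pos_of_pos (by positivity)
  rw [mul_div_assoc', div_le_div_iff₀ h1 h2, pow_succ]
  have h3 : Real.Gamma (((k + 1 : ℕ) : ℝ) / 2 + 1) ≤
      (k + 1) * √Real.pi * Real.Gamma (k / 2 + 1) := by
    refine hG.trans ?_
    gcongr
    nlinarith
  calc √Real.pi ^ k * Real.Gamma (((k + 1 : ℕ) : ℝ) / 2 + 1)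
      ≤ √Real.pi ^ k * ((k + 1) * √Real.pi * Real.Gamma (k / 2 + 1)) := by gcongr
    _ = _ := by ring

/-- Volume of a coordinate slab of the unit ball. -/
lemma volume_ball_inter_coord_slab_le {k : ℕ} (δ : ℝ) :
    volume {y : EuclideanSpace ℝ (Fin (k + 1)) | |y 0| < δ ∧ ‖y‖ < 1} ≤
      ENNReal.ofReal (2 * δ) * volume (ball (0 : EuclideanSpace ℝ (Fin k)) 1) := by
  set e := (MeasurableEquiv.piFinSuccAbove (fun _ : Fin (k + 1) => ℝ) 0)
  have he : MeasurePreserving e := volume_preserving_piFinSuccAbove (fun _ => ℝ) 0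
  have hf := he.comp (PiLp.volume_preserving_ofLp (Fin (k + 1)))
  set B : Set (Fin k → ℝ) := WithLp.toLp 2 ⁻¹' ball (0 : EuclideanSpace ℝ (Fin k)) 1
  have hBm : MeasurableSet B :=
    (PiLp.volume_preserving_toLp (Fin k)).measurable measurableSet_ball
  have hB : volume B = volume (ball (0 : EuclideanSpace ℝ (Fin k)) 1) :=
    (PiLp.volume_preserving_toLp (Fin k)).measure_preimage measurableSet_ball.nullMeasurableSet
  have hS : MeasurableSet (Ioo (-δ) δ ×ˢ B) := measurableSet_Ioo.prod hBm
  calc _ ≤ volume ((e ∘ WithLp.ofLp) ⁻¹' (Ioo (-δ) δ ×ˢ B) :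
        Set (EuclideanSpace ℝ (Fin (k + 1)))) := by
        apply measure_mono
        rintro y ⟨h0, h1⟩
        refine ⟨abs_lt.1 h0, ?_⟩
        simp only [B, mem_preimage, mem_ball_zero_iff]
        refine lt_of_le_of_lt ?_ h1
        rw [EuclideanSpace.norm_eq, EuclideanSpace.norm_eq]
        apply Real.sqrt_le_sqrt
        rw [Fin.sum_univ_succ (n := k)]
        simp only [e, MeasurableEquiv.piFinSuccAbove, Function.comp_apply]
        simp only [Fin.insertNthEquiv_zero, MeasurableEquiv.coe_mk, Fin.consEquiv_symm_apply,
          Real.norm_eq_abs, sq_abs, Fin.tail]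
        linarith [sq_nonneg (y.ofLp 0)]
    _ = volume (Ioo (-δ) δ ×ˢ B) := hf.measure_preimage hS.nullMeasurableSet
    _ = _ := by
      rw [Measure.volume_eq_prod, Measure.prod_prod, hB, Real.volume_Ioo]
      congr 2; ring

/-- Volume of a slab of the unit ball. -/
lemma volume_ball_inter_slab_le {k : ℕ} (u : EuclideanSpace ℝ (Fin (k + 1))) (hu : ‖u‖ = 1)
    (δ : ℝ) :
    volume {y : EuclideanSpace ℝ (Fin (k + 1)) | |inner ℝ u y| < δ ∧ ‖y‖ < 1} ≤
      ENNReal.ofReal (2 * δ) * volume (ball (0 : EuclideanSpace ℝ (Fin k)) 1) := by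
  obtain ⟨b, hb⟩ := Orthonormal.exists_orthonormalBasis_extension_of_card_eq (𝕜 := ℝ)
    (ι := Fin (k + 1)) (E := EuclideanSpace ℝ (Fin (k + 1))) (by simp) (v := fun _ => u) (s := {0})
    (by
      rw [orthonormal_iff_ite]
      rintro ⟨i, hi⟩ ⟨j, hj⟩
      simp only [mem_singleton_iff] at hi hj
      subst hi hj
      simp [hu])
  have hb0 : b 0 = u := hb 0 rfl
  have hT : MeasurableSet {y : EuclideanSpace ℝ (Fin (k + 1)) | |y 0| < δ ∧ ‖y‖ < 1} := by
    apply IsOpen.measurableSet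
    exact (isOpen_lt (f := fun y : EuclideanSpace ℝ (Fin (k + 1)) => |y 0|) (by fun_prop)
      continuous_const).inter (isOpen_lt (f := fun y => ‖y‖) (by fun_prop) continuous_const)
  refine le_trans (le_of_eq ?_) (volume_ball_inter_coord_slab_le δ)
  rw [← b.measurePreserving_repr.measure_preimage hT.nullMeasurableSet]
  congr 1
  ext y
  simp [OrthonormalBasis.repr_apply_apply, hb0]

/-- Comparison of the uniform measure of a set of directions with the volume of a set containing
the cone over it. -/
lemma sphereUniform_le_of_cone {m : ℕ} (hm : 1 ≤ m) {S K : Set (EuclideanSpace ℝ (Fin m))}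
    (hS : MeasurableSet S) (h : ∀ a ∈ S, ‖a‖ = 1 → ∀ r ∈ Ioo (0 : ℝ) 1, r • a ∈ K) :
    sphereUniform m S ≤ volume (K ∩ ball 0 1) / volume (ball (0 : EuclideanSpace ℝ (Fin m)) 1) := by
  have hS' : MeasurableSet (Subtype.val ⁻¹' S : Set (sphere (0 : EuclideanSpace ℝ (Fin m)) 1)) :=
    measurable_subtype_coe hS
  have hm' : (m : ℝ≥0∞) ≠ 0 := by exact_mod_cast (by omega : m ≠ 0)
  rw [sphereUniform, Measure.map_apply measurable_subtype_coe hS, Measure.smul_apply,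
    Measure.toSphere_apply' _ hS', Measure.toSphere_apply_univ, smul_eq_mul, mul_comm,
    ← ENNReal.div_eq_inv_mul.trans (mul_comm _ _)]
  rw [finrank_euclideanSpace, Fintype.card_fin,
    ENNReal.mul_div_mul_left _ _ hm' (ENNReal.natCast_ne_top m)]
  gcongr
  rintro _ ⟨r, hr, _, ⟨⟨a, ha⟩, haS, rfl⟩, rfl⟩
  have ha1 : ‖a‖ = 1 := by simpa using ha
  refine ⟨h a haS ha1 r hr, ?_⟩
  simp [norm_smul, ha1, abs_of_pos hr.1, hr.2]

/-- A slab of half-width `δ` has uniform measure at most `2 m δ`. -/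
lemma sphereUniform_slab_le {m : ℕ} (hm : 2 ≤ m) {u : EuclideanSpace ℝ (Fin m)} (hu : ‖u‖ = 1)
    (δ : ℝ) :
    sphereUniform m {a | |inner ℝ u a| < δ} ≤ ENNReal.ofReal (2 * m * δ) := by
  obtain ⟨k, rfl⟩ : ∃ k, m = k + 1 := ⟨m - 1, by omega⟩
  rcases le_or_gt δ 0 with hδ | hδ
  · have : {a | |inner ℝ u a| < δ} = ∅ := by
      ext a
      simpa using hδ.trans (abs_nonneg _)
    rw [this]; simp
  have hS : MeasurableSet {a | |inner ℝ u a| < δ} :=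
    (isOpen_lt (by fun_prop) continuous_const).measurableSet
  refine (sphereUniform_le_of_cone (by omega) (K := {a | |inner ℝ u a| < δ}) hS ?_).trans ?_
  · rintro a ha - r ⟨hr0, hr1⟩
    simp only [mem_ofPred_eq, inner_smul_right, abs_mul, abs_of_pos hr0] at ha ⊢
    nlinarith [abs_nonneg (inner ℝ u a)]
  have h1 : {a | |inner ℝ u a| < δ} ∩ ball 0 1 = {y | |inner ℝ u y| < δ ∧ ‖y‖ < 1} := by
    ext; simp
  rw [h1]
  apply ENNReal.div_le_of_le_mul
  refine (volume_ball_inter_slab_le u hu δ).trans ?_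
  refine (mul_le_mul_right (volume_ball_le_mul_volume_ball_succ (by omega)) _).trans ?_
  rw [← mul_assoc, ← ENNReal.ofReal_mul (by positivity)]
  apply le_of_eq
  congr 2
  push_cast
  ring

/-- The open half-ball and its antipode are disjoint, of equal volume, and both inside the ball. -/
lemma sphereUniform_inner_neg_le {m : ℕ} (hm : 1 ≤ m) (u : EuclideanSpace ℝ (Fin m)) :
    sphereUniform m {a | inner ℝ u a < 0} ≤ 1 / 2 := by
  set S := {a | inner ℝ u a < 0} with hSd
  have hS : MeasurableSet S := (isOpen_lt (by fun_prop) continuous_const).measurableSet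
  refine (sphereUniform_le_of_cone hm (K := S) hS ?_).trans ?_
  · rintro a ha - r ⟨hr0, hr1⟩
    simp only [S, mem_ofPred_eq, inner_smul_right] at ha ⊢
    exact mul_neg_of_pos_of_neg hr0 ha
  apply ENNReal.div_le_of_le_mul
  have hN : volume (-(S ∩ ball 0 1)) = volume (S ∩ ball 0 1) := Measure.measure_neg _ _
  have hd : Disjoint (S ∩ ball 0 1) (-(S ∩ ball 0 1)) := by
    rw [Set.disjoint_left]
    rintro a ⟨ha, -⟩ ⟨ha', -⟩
    simp only [S, mem_ofPred_eq, inner_neg_right] at ha ha'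
    linarith
  have hU : volume (S ∩ ball 0 1) + volume (S ∩ ball 0 1) ≤
      volume (ball (0 : EuclideanSpace ℝ (Fin m)) 1) := by
    nth_rewrite 2 [← hN]
    rw [← measure_union hd (hS.inter measurableSet_ball).neg]
    apply measure_mono
    rintro a (⟨-, ha⟩ | ⟨-, ha⟩)
    · exact ha
    · simpa using ha
  rw [← two_mul] at hU
  rw [one_div, ← ENNReal.div_eq_inv_mul, ENNReal.le_div_iff_mul_le (by simp) (by simp), mul_comm]
  exact hU

lemma sphereUniform_inner_le_le {m : ℕ} (hm : 2 ≤ m) {u : EuclideanSpace ℝ (Fin m)}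
    (hu : ‖u‖ = 1) {ε : ℝ} (hε : 0 < ε) :
    sphereUniform m {a | inner ℝ u a ≤ ε} ≤ 1 / 2 + ENNReal.ofReal (4 * m * ε) := by
  -- The width is doubled because the slab estimate is for strict inequalities.
  have h : {a | inner ℝ u a ≤ ε} ⊆ {a | inner ℝ u a < 0} ∪ {a | |inner ℝ u a| < 2 * ε} := by
    intro a ha
    simp only [mem_ofPred_eq, mem_union] at ha ⊢
    rcases lt_or_ge (inner ℝ u a) 0 with h0 | h0
    · exact Or.inl h0
    · right; rw [abs_of_nonneg h0]; linarith
  refine (measure_mono h).trans ((measure_union_le _ _).trans ?_)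
  refine add_le_add (sphereUniform_inner_neg_le (by omega) u) ?_
  refine (sphereUniform_slab_le hm hu _).trans (le_of_eq ?_)
  congr 1; ring

lemma ae_sphereUniform_norm_eq_one (m : ℕ) : ∀ᵐ a ∂sphereUniform m, ‖a‖ = 1 := by
  have hS : MeasurableSet {a : EuclideanSpace ℝ (Fin m) | ‖a‖ = 1} :=
    (isClosed_eq continuous_norm continuous_const).measurableSet
  rw [sphereUniform, ae_map_iff measurable_subtype_coe.aemeasurable hS]
  exact ae_of_all _ fun x => by simp

end

/-! ### Structure of the optimal direction -/

section

open Topology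

/-- For `A` with unit rows, `cos θ(A)` is the minimum over unit vectors `x` of the largest of the
inner products `a_i ⬝ x`. -/
lemma exists_optimal {n m : ℕ} (hn : 1 ≤ n) (hm : 1 ≤ m) (A : Matrix (Fin n) (Fin m) ℝ)
    (hA : ∀ i, ‖rowVec A i‖ = 1) :
    ∃ x : EuclideanSpace ℝ (Fin m), ‖x‖ = 1 ∧
      (∀ i, inner ℝ (rowVec A i) x ≤ Real.cos (maxMinAngle A)) ∧
      ∀ y, ∃ i, Real.cos (maxMinAngle A) * ‖y‖ ≤ inner ℝ (rowVec A i) y := by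
  have : Nonempty (Fin n) := ⟨⟨0, hn⟩⟩
  have : Nonempty (Fin m) := ⟨⟨0, hm⟩⟩
  have hne : (Finset.univ : Finset (Fin n)).Nonempty := Finset.univ_nonempty
  set g : EuclideanSpace ℝ (Fin m) → ℝ :=
    fun x => Finset.univ.sup' hne (fun i => inner ℝ (rowVec A i) x) with hg
  have hgc : Continuous g := Continuous.finset_sup'_apply hne fun i _ => by fun_prop
  obtain ⟨x, hx, hmin⟩ := (isCompact_sphere (0 : EuclideanSpace ℝ (Fin m)) 1).exists_isMinOn
    (NormedSpace.sphere_nonempty.2 zero_le_one) hgc.continuousOn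
  have hx1 : ‖x‖ = 1 := by simpa using hx
  have hle : ∀ i, inner ℝ (rowVec A i) x ≤ g x := fun i =>
    Finset.le_sup' (fun i => inner ℝ (rowVec A i) x) (Finset.mem_univ i)
  have hge : ∀ y, ∃ i, g x * ‖y‖ ≤ inner ℝ (rowVec A i) y := by
    intro y
    rcases eq_or_ne y 0 with rfl | hy
    · exact ⟨⟨0, hn⟩, by simp⟩
    have hy' : 0 < ‖y‖ := norm_pos_iff.2 hy
    have h1 : g x ≤ g (‖y‖⁻¹ • y) := hmin (by simp [norm_smul, hy'.ne'])
    obtain ⟨i, -, hi⟩ := Finset.exists_mem_eq_sup' hne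
      (fun i => inner ℝ (rowVec A i) (‖y‖⁻¹ • y))
    refine ⟨i, ?_⟩
    rw [hg] at h1
    simp only at h1
    rw [hi, inner_smul_right, ← div_eq_inv_mul, le_div_iff₀ hy'] at h1
    exact h1
  have hub : g x ≤ 1 := Finset.sup'_le hne _ fun i _ => by
    simpa [hA i, hx1] using real_inner_le_norm (rowVec A i) x
  have hlb : -1 ≤ g x := by
    refine le_trans ?_ (hle ⟨0, hn⟩)
    have := neg_le_of_abs_le (abs_real_inner_le_norm (rowVec A ⟨0, hn⟩) x)
    simpa [hA, hx1] using this
  have hbdd : ∀ y, BddBelow (Set.range fun i => InnerProductGeometry.angle (rowVec A i) y) :=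
    fun y => ⟨0, by rintro _ ⟨i, rfl⟩; exact InnerProductGeometry.angle_nonneg _ _⟩
  have hxne : x ≠ 0 := by rintro rfl; simp at hx1
  -- Since arccos is decreasing, the sup of min angles is the arccos of the min of max inner
  -- products.
  have hθ : maxMinAngle A = Real.arccos (g x) := by
    have hup : ∀ y : {y : EuclideanSpace ℝ (Fin m) // y ≠ 0},
        minAngle A y.1 ≤ Real.arccos (g x) := by
      rintro ⟨y, hy⟩
      obtain ⟨i, hi⟩ := hge y
      refine (ciInf_le (hbdd y) i).trans ?_
      apply Real.antitone_arccos
      rw [hA i, one_mul, le_div_iff₀ (norm_pos_iff.2 hy)]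
      exact hi
    have : Nonempty {y : EuclideanSpace ℝ (Fin m) // y ≠ 0} := ⟨⟨x, hxne⟩⟩
    apply le_antisymm (ciSup_le hup)
    refine le_trans ?_ (le_ciSup (f := fun y : {y : EuclideanSpace ℝ (Fin m) // y ≠ 0} =>
      minAngle A y.1) ⟨_, by rintro _ ⟨y, rfl⟩; exact hup y⟩ ⟨x, hxne⟩)
    refine le_ciInf fun i => Real.antitone_arccos ?_
    rw [hA i, hx1, one_mul, div_one]
    exact hle i
  rw [hθ, Real.cos_arccos hlb hub]
  exact ⟨x, hx1, hle, hge⟩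

section Optimal

variable {ι E : Type*} [NormedAddCommGroup E] [InnerProductSpace ℝ E]

/-- The combination of the `v j` that has inner product `1` with each of them, if they are linearly
independent. -/
noncomputable def unitSolution [Fintype ι] [DecidableEq ι] (v : ι → E) : E :=
  ∑ j, ((Matrix.gram ℝ v)⁻¹.mulVec 1) j • v j

lemma inner_sum_eq_gram_mulVec [Fintype ι] (v : ι → E) (c : ι → ℝ) (i : ι) :
    inner ℝ (v i) (∑ j, c j • v j) = (Matrix.gram ℝ v).mulVec c i := by
  simp [inner_sum, inner_smul_right, Matrix.mulVec, dotProduct, Matrix.gram_apply, mul_comm]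

lemma isUnit_det_gram [Fintype ι] [DecidableEq ι] {v : ι → E} (hv : LinearIndependent ℝ v) :
    IsUnit (Matrix.gram ℝ v).det :=
  isUnit_iff_ne_zero.2 (Matrix.posDef_gram_of_linearIndependent hv).det_pos.ne'

lemma inner_unitSolution [Fintype ι] [DecidableEq ι] {v : ι → E} (hv : LinearIndependent ℝ v)
    (i : ι) : inner ℝ (v i) (unitSolution v) = 1 := by
  rw [unitSolution, inner_sum_eq_gram_mulVec, Matrix.mulVec_mulVec,
    Matrix.mul_nonsing_inv _ (isUnit_det_gram hv), Matrix.one_mulVec]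
  rfl

/-- The Gram matrix is invertible, so the coefficients of x are forced. Hence the active rows alone
fix the line of the optimal x, which later allows conditioning on them. -/
lemma eq_smul_unitSolution [Fintype ι] [DecidableEq ι] {v : ι → E} (hv : LinearIndependent ℝ v)
    {x : E} {ρ : ℝ} (hx : x ∈ Submodule.span ℝ (Set.range v)) (h : ∀ i, inner ℝ (v i) x = ρ) :
    x = ρ • unitSolution v := by
  obtain ⟨c, rfl⟩ := (Submodule.mem_span_range_iff_exists_fun ℝ).1 hx
  have h1 : (Matrix.gram ℝ v).mulVec c = ρ • 1 := by
    ext i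
    rw [← inner_sum_eq_gram_mulVec, h]
    simp
  have h2 : c = ρ • (Matrix.gram ℝ v)⁻¹.mulVec 1 := by
    rw [← Matrix.mulVec_smul, ← h1, Matrix.mulVec_mulVec,
      Matrix.nonsing_inv_mul _ (isUnit_det_gram hv), Matrix.one_mulVec]
  rw [unitSolution, Finset.smul_sum]
  refine Finset.sum_congr rfl fun j _ => ?_
  rw [smul_smul]
  congr 1
  exact congrFun h2 j

variable {a : ι → E} {x : E} {ρ : ℝ}

/-- If `x` is optimal, then any small perturbation of `x` is dominated by a row active at `x`. -/
lemma eventually_exists_active [Finite ι] (hx : ‖x‖ = 1) (h1 : ∀ i, inner ℝ (a i) x ≤ ρ)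
    (h2 : ∀ y, ∃ i, ρ * ‖y‖ ≤ inner ℝ (a i) y) (w : E) :
    ∀ᶠ t in 𝓝 (0 : ℝ), ∃ i, inner ℝ (a i) x = ρ ∧
      ρ * ‖x + t • w‖ ≤ inner ℝ (a i) (x + t • w) := by
  -- Inactive rows are strictly below ρ at t = 0 and stay dominated by continuity.
  have h : ∀ᶠ t in 𝓝 (0 : ℝ), ∀ i, inner ℝ (a i) x ≠ ρ →
      inner ℝ (a i) (x + t • w) < ρ * ‖x + t • w‖ := by
    rw [eventually_all]
    intro i
    by_cases hi : inner ℝ (a i) x = ρ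
    · simp [hi]
    have hc1 : Continuous fun t : ℝ => (inner ℝ (a i) (x + t • w) : ℝ) := by fun_prop
    have hc2 : Continuous fun t : ℝ => ρ * ‖x + t • w‖ := by fun_prop
    have := hc1.continuousAt.eventually_lt (x₀ := 0) hc2.continuousAt
      (by simpa [hx] using lt_of_le_of_ne (h1 i) hi)
    filter_upwards [this] with t ht _ using ht
  filter_upwards [h] with t ht
  obtain ⟨i, hi⟩ := h2 (x + t • w)
  exact ⟨i, by_contra fun hne => absurd hi (not_le.2 (ht i hne)), hi⟩

/-- Otherwise let w be the component of x orthogonal to the active rows. Moving along w keeps their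
inner products at ρ but changes the norm of x, so one of the two directions improves the normalised
value. -/
lemma optimal_mem_span_active [FiniteDimensional ℝ E] [Finite ι] (hx : ‖x‖ = 1)
    (h1 : ∀ i, inner ℝ (a i) x ≤ ρ) (h2 : ∀ y, ∃ i, ρ * ‖y‖ ≤ inner ℝ (a i) y) (hρ : ρ ≠ 0) :
    x ∈ Submodule.span ℝ (a '' {i | inner ℝ (a i) x = ρ}) := by
  set W := Submodule.span ℝ (a '' {i | inner ℝ (a i) x = ρ})
  by_contra hxW
  set w := x - W.starProjection x with hw
  have hwW : w ∈ Wᗮ := W.sub_starProjection_mem_orthogonal x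
  have hw0 : w ≠ 0 := by
    intro h0
    apply hxW
    rw [sub_eq_zero.1 (hw.symm.trans h0)]
    exact W.starProjection_apply_mem x
  have hw1 : 0 < ‖w‖ ^ 2 := by positivity
  have hxw : inner ℝ x w = ‖w‖ ^ 2 := by
    have : x = w + W.starProjection x := by rw [hw]; abel
    nth_rewrite 1 [this]
    rw [inner_add_left, real_inner_self_eq_norm_sq,
      Submodule.inner_right_of_mem_orthogonal (W.starProjection_apply_mem x) hwW, add_zero]
  obtain ⟨δ, hδ, H⟩ := Metric.eventually_nhds_iff.1 (eventually_exists_active hx h1 h2 w)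
  have key : ∀ t, |t| < δ → ρ * ‖x + t • w‖ ≤ ρ := by
    intro t ht
    obtain ⟨i, hi, hle⟩ := H (y := t) (by simpa using ht)
    rwa [inner_add_right, inner_smul_right, hi, Submodule.inner_right_of_mem_orthogonal
      (Submodule.subset_span ⟨i, hi, rfl⟩ : a i ∈ W) hwW, mul_zero, add_zero] at hle
  have hnorm : ∀ t : ℝ, ‖x + t • w‖ ^ 2 = 1 + (2 * t + t ^ 2) * ‖w‖ ^ 2 := by
    intro t
    rw [norm_add_sq_real, inner_smul_right, hxw, norm_smul, hx, mul_pow, Real.norm_eq_abs, sq_abs]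
    ring
  -- s ≤ 1 makes -2s + s² negative, so t = -s shrinks the norm (used for ρ < 0) and t = s enlarges
  -- it (used for ρ > 0).
  set s := min (δ / 2) 1
  have hs : 0 < s := by positivity
  have hs1 : s ≤ 1 := min_le_right _ _
  have hsδ : s < δ := (min_le_left _ _).trans_lt (by linarith)
  rcases lt_or_gt_of_ne hρ with hneg | hpos
  · have h := key (-s) (by rwa [abs_neg, abs_of_pos hs])
    have h' : 1 ≤ ‖x + (-s) • w‖ := by nlinarith
    have := hnorm (-s)
    nlinarith [mul_pos hs hw1]
  · have h := key s (by rwa [abs_of_pos hs])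
    have h' : ‖x + s • w‖ ≤ 1 := by nlinarith
    have := hnorm s
    nlinarith [mul_pos hs hw1, norm_nonneg (x + s • w), mul_pos (pow_pos hs 2) hw1]

lemma exists_linearIndepOn_active [Finite ι] :
    ∃ J : Finset ι, LinearIndepOn ℝ a J ∧ (∀ j ∈ J, inner ℝ (a j) x = ρ) ∧
      ∀ i, inner ℝ (a i) x = ρ → a i ∈ Submodule.span ℝ (a '' J) := by
  obtain ⟨b, hb, -, hs, hli⟩ := exists_linearIndepOn_extension (linearIndepOn_empty ℝ a)
    (Set.empty_subset {i | inner ℝ (a i) x = ρ})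
  refine ⟨b.toFinite.toFinset, by simpa using hli, fun j hj => hb (by simpa using hj),
    fun i hi => ?_⟩
  simpa using hs ⟨i, hi, rfl⟩

/-- A nonzero optimal value is the common value at `x` of linearly independent rows whose span
contains `x`. -/
lemma exists_linearIndepOn_of_optimal [FiniteDimensional ℝ E] [Finite ι] (hx : ‖x‖ = 1)
    (h1 : ∀ i, inner ℝ (a i) x ≤ ρ) (h2 : ∀ y, ∃ i, ρ * ‖y‖ ≤ inner ℝ (a i) y) (hρ : ρ ≠ 0) :
    ∃ J : Finset ι, LinearIndepOn ℝ a J ∧ (∀ j ∈ J, inner ℝ (a j) x = ρ) ∧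
      x ∈ Submodule.span ℝ (a '' J) := by
  obtain ⟨J, hli, hJ, hs⟩ := exists_linearIndepOn_active (a := a) (x := x) (ρ := ρ)
  refine ⟨J, hli, hJ, ?_⟩
  have := optimal_mem_span_active hx h1 h2 hρ
  refine (Submodule.span_le.2 ?_) this
  rintro _ ⟨i, hi, rfl⟩
  exact hs i hi

lemma card_le_finrank_of_linearIndepOn [FiniteDimensional ℝ E] {J : Finset ι}
    (h : LinearIndepOn ℝ a J) : J.card ≤ Module.finrank ℝ E := by
  simpa using LinearIndependent.fintype_card_le_finrank h

/-- If the optimal value is zero, then some row is in the span of few others. -/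
lemma exists_mem_span_of_optimal_zero [FiniteDimensional ℝ E] [Finite ι] (hx : ‖x‖ = 1)
    (h1 : ∀ i, inner ℝ (a i) x ≤ 0) (h2 : ∀ y, ∃ i, 0 * ‖y‖ ≤ inner ℝ (a i) y) :
    ∃ (i : ι) (J : Finset ι), i ∉ J ∧ J.card < Module.finrank ℝ E ∧
      a i ∈ Submodule.span ℝ (a '' J) := by
  classical
  obtain ⟨J, hli, hJ, hs⟩ := exists_linearIndepOn_active (a := a) (x := x) (ρ := 0)
  -- If every active row were in J, a small step along `-z` would make all of them negative, against
  -- optimality.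
  obtain ⟨i, hi, hiJ⟩ : ∃ i, inner ℝ (a i) x = 0 ∧ i ∉ J := by
    by_contra! hcon
    set z := unitSolution fun j : J => a j
    have hz : ∀ j ∈ J, inner ℝ (a j) z = 1 := fun j hj =>
      inner_unitSolution (v := fun j : J => a j) hli ⟨j, hj⟩
    obtain ⟨δ, hδ, H⟩ := Metric.eventually_nhds_iff.1 (eventually_exists_active hx h1 h2 z)
    obtain ⟨i, hi, hle⟩ := H (y := -(δ / 2)) (by simp [abs_of_pos hδ, hδ])
    rw [zero_mul, inner_add_right, inner_smul_right, hi, hz i (hcon i hi)] at hle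
    linarith
  refine ⟨i, J, hiJ, ?_, hs i hi⟩
  -- With full cardinality J would span the space, while x is orthogonal to its rows.
  refine lt_of_le_of_ne (card_le_finrank_of_linearIndepOn hli) fun hc => ?_
  have htop : Submodule.span ℝ (Set.range fun j : J => a j) = ⊤ :=
    LinearIndependent.span_eq_top_of_card_eq_finrank' hli (by simpa using hc)
  have hx0 : x ∈ (Submodule.span ℝ (Set.range fun j : J => a j))ᗮ := by
    rw [Submodule.mem_orthogonal]
    intro u hu
    induction hu using Submodule.span_induction with
    | mem u hu => obtain ⟨j, rfl⟩ := hu; exact hJ j j.2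
    | zero => simp
    | add u v _ _ hu hv => rw [inner_add_left, hu, hv, add_zero]
    | smul c u _ hu => rw [inner_smul_left, hu, mul_zero]
  rw [htop, Submodule.top_orthogonal_eq_bot, Submodule.mem_bot] at hx0
  simp [hx0] at hx

/-- If the optimal value is small, then some row is close to the span of few others. -/
lemma exists_norm_sub_le_of_optimal [FiniteDimensional ℝ E] [Finite ι] (hx : ‖x‖ = 1)
    (h1 : ∀ i, inner ℝ (a i) x ≤ ρ) (h2 : ∀ y, ∃ i, ρ * ‖y‖ ≤ inner ℝ (a i) y) :
    ∃ (i : ι) (J : Finset ι), i ∉ J ∧ J.card < Module.finrank ℝ E ∧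
      ∃ c : J → ℝ, ‖a i - ∑ j, c j • a j‖ ≤ Module.finrank ℝ E * |ρ| := by
  classical
  rcases eq_or_ne ρ 0 with rfl | hρ
  · obtain ⟨i, J, hi, hJ, hs⟩ := exists_mem_span_of_optimal_zero hx h1 h2
    refine ⟨i, J, hi, hJ, ?_⟩
    obtain ⟨c, hc⟩ := Submodule.mem_span_image_finset_iff_exists_fun ℝ |>.1 hs
    exact ⟨c, by simp [← hc]⟩
  obtain ⟨J, hli, hJ, hs⟩ := exists_linearIndepOn_of_optimal hx h1 h2 hρ
  have hcard := card_le_finrank_of_linearIndepOn hli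
  obtain ⟨c, hc⟩ := Submodule.mem_span_image_finset_iff_exists_fun' ℝ |>.1 hs
  have hsum : ∑ j ∈ J, c j * ρ = 1 := by
    have : inner ℝ x x = (1 : ℝ) := by rw [real_inner_self_eq_norm_sq, hx, one_pow]
    rw [← this]
    nth_rewrite 1 [← hc]
    rw [sum_inner]
    refine Finset.sum_congr rfl fun j hj => ?_
    rw [inner_smul_left, hJ j hj]
    rfl
  -- From ρ·∑ c_j = 1 with at most dim E terms, some |c_j| is at least 1/(dim E·|ρ|). Solving x = ∑
  -- c_j a_j for that row leaves a remainder of norm 1/|c_j|.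
  obtain ⟨j, hj, hjc⟩ : ∃ j ∈ J, 1 ≤ Module.finrank ℝ E * |ρ| * |c j| := by
    by_contra! hcon
    have hne : J.Nonempty := by
      rw [Finset.nonempty_iff_ne_empty]; rintro rfl; simp at hsum
    have hd : (0 : ℝ) < Module.finrank ℝ E := by
      exact_mod_cast hne.card_pos.trans_le hcard
    have : (Module.finrank ℝ E : ℝ) * 1 < J.card := by
      calc (Module.finrank ℝ E : ℝ) * 1 ≤ ∑ j ∈ J, Module.finrank ℝ E * |ρ| * |c j| := by
            rw [← hsum, Finset.mul_sum]
            refine Finset.sum_le_sum fun j _ => ?_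
            rw [mul_assoc, ← abs_mul, mul_comm ρ]
            gcongr
            exact le_abs_self _
        _ < ∑ j ∈ J, 1 := Finset.sum_lt_sum_of_nonempty hne hcon
        _ = J.card := by simp
    have : (J.card : ℝ) ≤ Module.finrank ℝ E := by exact_mod_cast hcard
    linarith
  have hc0 : c j ≠ 0 := by rintro h0; simp [h0] at hjc; linarith
  refine ⟨j, J.erase j, by simp, (Finset.card_erase_lt_of_mem hj).trans_le hcard,
    fun k => -(c k / c j), ?_⟩
  have : a j - ∑ k : J.erase j, -(c k / c j) • a k = (c j)⁻¹ • x := by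
    rw [Finset.sum_coe_sort (J.erase j) (fun k => -(c k / c j) • a k), ← hc,
      ← Finset.add_sum_erase J _ hj, smul_add, smul_smul, inv_mul_cancel₀ hc0, one_smul,
      Finset.smul_sum, sub_eq_add_neg, ← Finset.sum_neg_distrib]
    congr 1
    refine Finset.sum_congr rfl fun k _ => ?_
    rw [neg_smul, neg_neg, smul_smul, div_eq_inv_mul]
  rw [this, norm_smul, hx, mul_one, norm_inv, Real.norm_eq_abs, inv_le_iff_one_le_mul₀ (by positivity)]
  exact hjc

end Optimal

end

/-! ### Small-ball estimates for cos θ(A) -/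

section

section Independence

variable {Ω ι E : Type*} [MeasurableSpace Ω] {P : Measure Ω} [IsProbabilityMeasure P]
  [MeasurableSpace E] {σ : Measure E} {X : ι → Ω → E}

/-- Given the variables with index in `J`, the variables with index in `T` are still independent:
the probability that all of them satisfy a condition depending on the former is at most a power of
the worst conditional probability. -/
lemma measure_forall_mem_le_pow (hX : ∀ i, Measurable (X i)) (hind : iIndepFun X P)
    (hσ : ∀ i, P.map (X i) = σ) {J T : Finset ι} (hJT : Disjoint J T)
    {D : Set ((J → E) × E)} (hD : MeasurableSet D) {q : ℝ≥0∞}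
    (hq : ∀ v, σ {a | (v, a) ∈ D} ≤ q) :
    P {ω | ∀ i ∈ T, ((fun j : J => X j ω), X i ω) ∈ D} ≤ q ^ T.card := by
  rcases T.eq_empty_or_nonempty with rfl | ⟨i₀, -⟩
  · simp
  have : IsProbabilityMeasure σ := hσ i₀ ▸ Measure.isProbabilityMeasure_map (hX i₀).aemeasurable
  have hXJ : Measurable fun ω => fun j : J => X j ω := measurable_pi_lambda _ fun j => hX j
  have hXT : Measurable fun ω => fun i : T => X i ω := measurable_pi_lambda _ fun j => hX j
  have h1 : IndepFun (fun ω => fun j : J => X j ω) (fun ω => fun i : T => X i ω) P :=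
    hind.indepFun_finset J T hJT hX
  have h2 : P.map (fun ω => fun i : T => X i ω) = Measure.pi fun _ => σ := by
    have := (iIndepFun_iff_map_fun_eq_pi_map (f := fun i : T => X i)
      fun i => (hX i).aemeasurable).1 (hind.precomp Subtype.val_injective)
    simpa [hσ] using this
  have h3 := (indepFun_iff_map_prod_eq_prod_map_map hXJ.aemeasurable hXT.aemeasurable).1 h1
  rw [h2] at h3
  have : IsProbabilityMeasure (P.map fun ω => fun j : J => X j ω) :=
    Measure.isProbabilityMeasure_map hXJ.aemeasurable
  set D' : Set ((J → E) × (T → E)) := {p | ∀ i, (p.1, p.2 i) ∈ D} with hD'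
  have hD'm : MeasurableSet D' := by
    have : D' = ⋂ i, (fun p : (J → E) × (T → E) => (p.1, p.2 i)) ⁻¹' D := by
      ext; simp [hD']
    rw [this]
    exact MeasurableSet.iInter fun i => (by fun_prop : Measurable _) hD
  calc P {ω | ∀ i ∈ T, ((fun j : J => X j ω), X i ω) ∈ D}
      = P.map (fun ω => ((fun j : J => X j ω), fun i : T => X i ω)) D' := by
        rw [Measure.map_apply (hXJ.prodMk hXT) hD'm]
        congr 1
        ext ω
        simp [hD']
    _ = ∫⁻ v, Measure.pi (fun _ : T => σ) (Prod.mk v ⁻¹' D') ∂_ := by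
        rw [h3, Measure.prod_apply hD'm]
    _ ≤ ∫⁻ _, q ^ T.card ∂(P.map fun ω => fun j : J => X j ω) := by
        refine lintegral_mono fun v => ?_
        have : Prod.mk v ⁻¹' D' = Set.univ.pi fun _ : T => {a | (v, a) ∈ D} := by
          ext; simp [hD']
        rw [this, Measure.pi_pi, Finset.prod_const, Finset.card_univ, Fintype.card_coe]
        exact pow_le_pow_left' (hq v) _
    _ = q ^ T.card := by simp

end Independence

lemma ae_norm_rowVec {Ω : Type*} [MeasurableSpace Ω] {P : Measure Ω} {m n : ℕ}
    {A : Ω → Matrix (Fin n) (Fin m) ℝ} (hA : IsUniformRandomMatrix P A) :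
    ∀ᵐ ω ∂P, ∀ i, ‖rowVec (A ω) i‖ = 1 := by
  rw [ae_all_iff]
  intro i
  have := ae_sphereUniform_norm_eq_one m
  rw [← hA.law_row i] at this
  exact ae_of_ae_map (hA.measurable_row i).aemeasurable this

variable {Ω : Type*} [MeasurableSpace Ω] {P : Measure Ω} [IsProbabilityMeasure P] {m n : ℕ}
  {A : Ω → Matrix (Fin n) (Fin m) ℝ}

lemma exists_unit_orthogonal {k : Type*} [Fintype k] (hk : Fintype.card k < m)
    (v : k → EuclideanSpace ℝ (Fin m)) : ∃ u, ‖u‖ = 1 ∧ ∀ j, inner ℝ u (v j) = 0 := by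
  set W := Submodule.span ℝ (Set.range v)
  have hW : W ≠ ⊤ := by
    intro h
    have h1 : Module.finrank ℝ W ≤ Fintype.card k := finrank_range_le_card v
    rw [h, finrank_top, finrank_euclideanSpace, Fintype.card_fin] at h1
    omega
  obtain ⟨w, hw, hw0⟩ := Submodule.exists_mem_ne_zero_of_ne_bot
    (mt Submodule.orthogonal_eq_bot_iff.1 hW)
  refine ⟨‖w‖⁻¹ • w, by simp [norm_smul, hw0], fun j => ?_⟩
  rw [inner_smul_left, Submodule.inner_left_of_mem_orthogonal
    (Submodule.subset_span ⟨j, rfl⟩ : v j ∈ W) hw, mul_zero]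

/-- A row is unlikely to be close to the span of fewer than `m` others. -/
lemma measure_near_span_le (hm : 2 ≤ m) (hA : IsUniformRandomMatrix P A) {i : Fin n}
    {J : Finset (Fin n)} (hi : i ∉ J) (hJ : J.card < m) (δ : ℝ) :
    P {ω | ∃ c : J → ℝ, ‖rowVec (A ω) i - ∑ j, c j • rowVec (A ω) j‖ < δ} ≤
      ENNReal.ofReal (2 * m * δ) := by
  set D : Set ((J → EuclideanSpace ℝ (Fin m)) × EuclideanSpace ℝ (Fin m)) :=
    {p | ∃ c : J → ℝ, ‖p.2 - ∑ j, c j • p.1 j‖ < δ} with hD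
  have hDm : MeasurableSet D := by
    -- The union is uncountable, but each set is open.
    have : D = ⋃ c : J → ℝ, {p | ‖p.2 - ∑ j, c j • p.1 j‖ < δ} := by
      ext; simp [hD]
    rw [this]
    exact (isOpen_iUnion fun c => isOpen_lt (by fun_prop) continuous_const).measurableSet
  have h := measure_forall_mem_le_pow hA.measurable_row hA.indep_rows hA.law_row
    (Finset.disjoint_singleton_right.2 hi) hDm (q := ENNReal.ofReal (2 * m * δ)) ?_
  · simpa [hD] using h
  intro v
  -- Points within δ of the span lie in the slab of half-width δ normal to u.
  obtain ⟨u, hu, huv⟩ := exists_unit_orthogonal (by simpa using hJ) v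
  refine le_trans (measure_mono ?_) (sphereUniform_slab_le hm hu δ)
  rintro a ⟨c, hc⟩
  simp only [Set.mem_ofPred_eq]
  have : inner ℝ u a = inner ℝ u (a - ∑ j, c j • v j) := by
    simp [inner_sub_right, inner_sum, inner_smul_right, huv]
  rw [this]
  refine lt_of_le_of_lt (abs_real_inner_le_norm _ _) ?_
  rwa [hu, one_mul]

/-- The inverse Gram matrix is the adjugate times the inverse determinant; inversion on ℝ, with 0⁻¹
= 0, is measurable though not continuous. -/
lemma measurable_unitSolution {k E : Type*} [Fintype k] [DecidableEq k] [NormedAddCommGroup E]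
    [InnerProductSpace ℝ E] [MeasurableSpace E] [BorelSpace E] [SecondCountableTopology E] :
    Measurable (unitSolution : (k → E) → E) := by
  have hinv : ∀ i j, Measurable fun v : k → E => (Matrix.gram ℝ v)⁻¹ i j := by
    intro i j
    simp only [Matrix.inv_def, Matrix.smul_apply, smul_eq_mul, Ring.inverse_eq_inv']
    have h1 : Continuous fun v : k → E => Matrix.gram ℝ v :=
      continuous_matrix fun i j => by simp only [Matrix.gram_apply]; fun_prop
    exact h1.matrix_det.measurable.inv.mul (h1.matrix_adjugate.matrix_elem i j).measurable
  unfold unitSolution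
  refine Finset.measurable_sum _ fun j _ => ?_
  refine Measurable.smul ?_ (measurable_pi_apply j)
  simp only [Matrix.mulVec, dotProduct]
  exact Finset.measurable_sum _ fun i _ => (hinv j i).mul measurable_const

/-- The direction singled out by the rows with index in `J` is unlikely to be nearly feasible for
the other rows. -/
lemma measure_unitSolution_feasible_le (hm : 2 ≤ m) (hA : IsUniformRandomMatrix P A)
    (J : Finset (Fin n)) {ε s : ℝ} (hε : 0 < ε) (hs : |s| = 1) :
    P {ω | unitSolution (fun j : J => rowVec (A ω) j) ≠ 0 ∧
        ∀ i, s * inner ℝ (unitSolution fun j : J => rowVec (A ω) j) (rowVec (A ω) i) ≤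
          ε * ‖unitSolution fun j : J => rowVec (A ω) j‖} ≤
      (1 / 2 + ENNReal.ofReal (4 * m * ε)) ^ (n - J.card) := by
  set D : Set ((J → EuclideanSpace ℝ (Fin m)) × EuclideanSpace ℝ (Fin m)) :=
    {p | unitSolution p.1 ≠ 0 ∧ s * inner ℝ (unitSolution p.1) p.2 ≤ ε * ‖unitSolution p.1‖} with hD
  have hu : Measurable fun p : (J → EuclideanSpace ℝ (Fin m)) × EuclideanSpace ℝ (Fin m) =>
    unitSolution p.1 := measurable_unitSolution.comp measurable_fst
  have hDm : MeasurableSet D :=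
    (hu (measurableSet_singleton 0).compl).inter
      (measurableSet_le ((hu.inner measurable_snd).const_mul s) (hu.norm.const_mul ε))
  have h := measure_forall_mem_le_pow hA.measurable_row hA.indep_rows hA.law_row
    (disjoint_compl_right (a := J)) hDm (q := 1 / 2 + ENNReal.ofReal (4 * m * ε)) ?_
  · rw [Finset.card_compl, Fintype.card_fin] at h
    refine (measure_mono ?_).trans h
    rintro ω ⟨h0, h1⟩ i -
    exact ⟨h0, h1 i⟩
  intro v
  rcases eq_or_ne (unitSolution v) 0 with h0 | h0
  · simp [hD, h0]
  have hpos : 0 < ‖unitSolution v‖ := norm_pos_iff.2 h0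
  refine le_trans (measure_mono ?_)
    (sphereUniform_inner_le_le hm (u := (s / ‖unitSolution v‖) • unitSolution v) ?_ hε)
  · rintro a ⟨-, ha⟩
    simp only [Set.mem_ofPred_eq] at ha ⊢
    rw [inner_smul_left, RCLike.conj_to_real, div_mul_eq_mul_div, div_le_iff₀ hpos]
    exact ha
  · rw [norm_smul, norm_div, norm_norm, Real.norm_eq_abs, hs, one_div, inv_mul_cancel₀ hpos.ne']

/-- A small-ball bound for `cos θ(A)`, useful for very small `ε`. -/
lemma measure_abs_cos_le (hm : 2 ≤ m) (hn : 1 ≤ n) (hA : IsUniformRandomMatrix P A) {ε : ℝ}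
    (hε : 0 < ε) :
    P {ω | |Real.cos (maxMinAngle (A ω))| ≤ ε} ≤
      ENNReal.ofReal (n * 2 ^ n * (4 * m ^ 2 * ε)) := by
  set B : Fin n → Finset (Fin n) → Set Ω := fun i J =>
    {ω | i ∉ J ∧ J.card < m ∧
      ∃ c : J → ℝ, ‖rowVec (A ω) i - ∑ j, c j • rowVec (A ω) j‖ < 2 * m * ε} with hB
  have hm0 : (0 : ℝ) < m := by exact_mod_cast (by omega : 0 < m)
  have hsub : ({ω | |Real.cos (maxMinAngle (A ω))| ≤ ε} : Set Ω) ≤ᵐ[P]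
      (⋃ i, ⋃ J, B i J : Set Ω) := by
    filter_upwards [ae_norm_rowVec hA] with ω hω hle
    obtain ⟨x, hx, h1, h2⟩ := exists_optimal hn (by omega) (A ω) hω
    obtain ⟨i, J, hi, hJ, c, hc⟩ := exists_norm_sub_le_of_optimal hx h1 h2
    rw [finrank_euclideanSpace, Fintype.card_fin] at hJ hc
    refine Set.mem_iUnion₂.2 ⟨i, J, hi, hJ, c, hc.trans_lt ?_⟩
    have : |Real.cos (maxMinAngle (A ω))| ≤ ε := hle
    nlinarith [mul_pos hm0 hε, mul_le_mul_of_nonneg_left this hm0.le]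
  have hBle : ∀ i J, P (B i J) ≤ ENNReal.ofReal (4 * m ^ 2 * ε) := by
    intro i J
    by_cases h : i ∉ J ∧ J.card < m
    · refine (measure_mono ?_).trans
        ((measure_near_span_le hm hA h.1 h.2 (2 * m * ε)).trans (le_of_eq ?_))
      · rintro ω ⟨-, -, hc⟩; exact hc
      · congr 1; ring
    · have : B i J = ∅ := by
        ext ω; simp only [hB, Set.mem_ofPred_eq, Set.mem_empty_iff_false]; tauto
      simp [this]
  calc P {ω | |Real.cos (maxMinAngle (A ω))| ≤ ε} ≤ P (⋃ i, ⋃ J, B i J) := measure_mono_ae hsub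
    _ ≤ ∑ i, ∑ J, P (B i J) :=
        (measure_iUnion_fintype_le _ _).trans
          (Finset.sum_le_sum fun i _ => measure_iUnion_fintype_le _ _)
    _ ≤ ∑ _i : Fin n, ∑ _J : Finset (Fin n), ENNReal.ofReal (4 * m ^ 2 * ε) :=
        Finset.sum_le_sum fun i _ => Finset.sum_le_sum fun J _ => hBle i J
    _ = _ := by
      generalize 4 * (m : ℝ) ^ 2 * ε = x
      simp only [Finset.sum_const, Finset.card_univ, Fintype.card_finset, Fintype.card_fin,
        nsmul_eq_mul]
      rw [ENNReal.ofReal_mul (by positivity), ENNReal.ofReal_mul (by positivity),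
        ENNReal.ofReal_natCast, ENNReal.ofReal_pow (by norm_num), mul_assoc]
      simp

/-- Let ε → 0 in the previous bound. This discards ρ = 0, where the optimal x need not be a multiple
of a `unitSolution`. -/
lemma measure_cos_eq_zero (hm : 2 ≤ m) (hn : 1 ≤ n) (hA : IsUniformRandomMatrix P A) :
    P {ω | Real.cos (maxMinAngle (A ω)) = 0} = 0 := by
  have h : ∀ ε > 0, P {ω | Real.cos (maxMinAngle (A ω)) = 0} ≤
      ENNReal.ofReal (n * 2 ^ n * (4 * m ^ 2 * ε)) := fun ε hε =>
    (measure_mono fun ω hω => by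
      simp only [Set.mem_ofPred_eq] at hω ⊢; simp [hω, hε.le]).trans (measure_abs_cos_le hm hn hA hε)
  have hlim : Tendsto (fun ε : ℝ => ENNReal.ofReal (n * 2 ^ n * (4 * m ^ 2 * ε)))
      (nhdsWithin 0 (Set.Ioi 0)) (nhds 0) := by
    have : Continuous fun ε : ℝ => ENNReal.ofReal (n * 2 ^ n * (4 * m ^ 2 * ε)) :=
      ENNReal.continuous_ofReal.comp (by fun_prop)
    simpa using (this.tendsto 0).mono_left nhdsWithin_le_nhds
  exact le_antisymm (ge_of_tendsto hlim (eventually_nhdsWithin_of_forall h)) zero_le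

/-- A small-ball bound for `cos θ(A)`, useful for many rows. -/
lemma measure_abs_cos_le_pow (hm : 2 ≤ m) (hn : 1 ≤ n) (hA : IsUniformRandomMatrix P A) {ε : ℝ}
    (hε : 0 < ε) :
    P {ω | |Real.cos (maxMinAngle (A ω))| ≤ ε} ≤
      2 * (8 ^ m * (1 / 8 + (1 / 2 + ENNReal.ofReal (4 * m * ε))) ^ n) := by
  set q := 1 / 2 + ENNReal.ofReal (4 * m * ε)
  -- The sign s is that of ρ: x is a positive multiple of s times the unit solution.
  set B : ℝ → Finset (Fin n) → Set Ω := fun s J =>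
    {ω | J.card ≤ m ∧ unitSolution (fun j : J => rowVec (A ω) j) ≠ 0 ∧
        ∀ i, s * inner ℝ (unitSolution fun j : J => rowVec (A ω) j) (rowVec (A ω) i) ≤
          ε * ‖unitSolution fun j : J => rowVec (A ω) j‖} with hB
  have hsub : ({ω | |Real.cos (maxMinAngle (A ω))| ≤ ε} : Set Ω) ≤ᵐ[P]
      (⋃ J, (B 1 J ∪ B (-1) J) : Set Ω) := by
    have h0 : ∀ᵐ ω ∂P, Real.cos (maxMinAngle (A ω)) ≠ 0 := by
      rw [ae_iff]; simpa using measure_cos_eq_zero hm hn hA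
    filter_upwards [ae_norm_rowVec hA, h0] with ω hω hρ hle
    have hle' : |Real.cos (maxMinAngle (A ω))| ≤ ε := hle
    obtain ⟨x, hx, h1, h2⟩ := exists_optimal hn (by omega) (A ω) hω
    obtain ⟨J, hli, hJ, hs⟩ := exists_linearIndepOn_of_optimal hx h1 h2 hρ
    have hcard := card_le_finrank_of_linearIndepOn hli
    rw [finrank_euclideanSpace, Fintype.card_fin] at hcard
    rw [Set.image_eq_range] at hs
    have hxy := eq_smul_unitSolution (v := fun j : J => rowVec (A ω) j) hli hs
      fun j => hJ j j.2
    set y := unitSolution fun j : J => rowVec (A ω) j with hy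
    set ρ := Real.cos (maxMinAngle (A ω))
    have hy0 : y ≠ 0 := by rintro h; rw [h, smul_zero] at hxy; simp [hxy] at hx
    have hn1 : |ρ| * ‖y‖ = 1 := by rw [← Real.norm_eq_abs, ← norm_smul, ← hxy, hx]
    have hin : ∀ i, ρ * inner ℝ y (rowVec (A ω) i) ≤ |ρ| * (ε * ‖y‖) := by
      intro i
      have : ρ * inner ℝ y (rowVec (A ω) i) = inner ℝ (rowVec (A ω) i) x := by
        rw [hxy, inner_smul_right, real_inner_comm]
      rw [this, mul_left_comm, hn1, mul_one]
      exact (h1 i).trans ((le_abs_self _).trans hle')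
    refine Set.mem_iUnion.2 ⟨J, ?_⟩
    rcases lt_or_gt_of_ne hρ with hneg | hpos
    · refine Or.inr ⟨hcard, hy0, fun i => ?_⟩
      have := hin i
      rw [abs_of_neg hneg] at this
      refine le_of_mul_le_mul_left ?_ (neg_pos.2 hneg)
      linarith
    · refine Or.inl ⟨hcard, hy0, fun i => ?_⟩
      have := hin i
      rw [abs_of_pos hpos] at this
      rw [one_mul]
      exact le_of_mul_le_mul_left this hpos
  -- The factor 8^(m - |J|) ≥ 1 replaces the restriction |J| ≤ m, so the sum over all J is a
  -- binomial expansion.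
  have hBle : ∀ s J, |s| = 1 → P (B s J) ≤ 8 ^ m * ((1 / 8) ^ J.card * q ^ (n - J.card)) := by
    intro s J hs
    by_cases h : J.card ≤ m
    · refine (measure_mono (fun ω hω => hω.2)).trans
        ((measure_unitSolution_feasible_le hm hA J hε hs).trans ?_)
      rw [← mul_assoc]
      refine le_mul_of_one_le_left zero_le ?_
      obtain ⟨d, rfl⟩ := Nat.exists_eq_add_of_le h
      rw [pow_add, mul_right_comm, ← mul_pow, one_div, ENNReal.mul_inv_cancel (by simp) (by simp),
        one_pow, one_mul]
      exact one_le_pow₀ (by norm_num)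
    · have : B s J = ∅ := by
        ext ω; simp only [hB, Set.mem_ofPred_eq, Set.mem_empty_iff_false]; tauto
      simp [this]
  calc P {ω | |Real.cos (maxMinAngle (A ω))| ≤ ε} ≤ P (⋃ J, (B 1 J ∪ B (-1) J)) :=
        measure_mono_ae hsub
    _ ≤ ∑ J, P (B 1 J ∪ B (-1) J) := measure_iUnion_fintype_le _ _
    _ ≤ ∑ J : Finset (Fin n), 2 * (8 ^ m * ((1 / 8) ^ J.card * q ^ (n - J.card))) := by
        refine Finset.sum_le_sum fun J _ => (measure_union_le _ _).trans ?_
        rw [two_mul]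
        exact add_le_add (hBle 1 J (by simp)) (hBle (-1) J (by simp))
    _ = _ := by
      rw [← Finset.mul_sum, ← Finset.mul_sum, Fin.sum_pow_mul_eq_add_pow]

end

/-! ### From tail bounds to the expectation -/

section

lemma le_tsum_indicator_lt (x y : ℝ≥0∞) :
    x ≤ y + ∑' k : ℕ, if y + k < x then (1 : ℝ≥0∞) else 0 := by
  rcases eq_or_ne x ⊤ with rfl | hx
  · rcases eq_or_ne y ⊤ with rfl | hy
    · simp
    have : ∀ k : ℕ, y + k < ⊤ := fun k =>
      ENNReal.add_lt_top.2 ⟨hy.lt_top, ENNReal.natCast_lt_top k⟩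
    simp [this]
  obtain ⟨N, hN⟩ : ∃ N : ℕ, x ≤ y + N := by
    obtain ⟨N, hN⟩ := ENNReal.exists_nat_gt hx
    exact ⟨N, hN.le.trans le_add_self⟩
  classical
  have hmin := Nat.find_spec (⟨N, hN⟩ : ∃ N : ℕ, x ≤ y + N)
  set M := Nat.find (⟨N, hN⟩ : ∃ N : ℕ, x ≤ y + N)
  refine hmin.trans (add_le_add_right ?_ y)
  calc (M : ℝ≥0∞) = ∑ k ∈ Finset.range M, if y + k < x then (1 : ℝ≥0∞) else 0 := by
        have : ∀ k ∈ Finset.range M, y + k < x := fun k hk =>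
          not_le.1 (Nat.find_min (⟨N, hN⟩ : ∃ N : ℕ, x ≤ y + N) (Finset.mem_range.1 hk))
        rw [Finset.sum_congr rfl fun k hk => if_pos (this k hk)]
        simp
    _ ≤ _ := ENNReal.sum_le_tsum _

/-- Where f exceeds s, it is bounded by t plus the number of unit layers above t that it enters.
Measurable hulls of the level sets make measurability of f unnecessary. -/
lemma lintegral_le_add_tsum_measure {Ω : Type*} [MeasurableSpace Ω] {P : Measure Ω}
    [IsProbabilityMeasure P] (f : Ω → ℝ≥0∞) (s t : ℝ≥0∞) :
    ∫⁻ ω, f ω ∂P ≤ s + t * P {ω | s < f ω} + ∑' k : ℕ, P {ω | t + k < f ω} := by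
  set S : ℝ≥0∞ → Set Ω := fun r => toMeasurable P {ω | r < f ω}
  have hS : ∀ r, MeasurableSet (S r) := fun r => measurableSet_toMeasurable _ _
  have hP : ∀ r, P (S r) = P {ω | r < f ω} := fun r => measure_toMeasurable _
  have hmem : ∀ r ω, r < f ω → ω ∈ S r := fun r ω h => subset_toMeasurable P _ h
  have hone : ∀ r ω, (if r < f ω then (1 : ℝ≥0∞) else 0) ≤ (S r).indicator 1 ω := by
    intro r ω
    split_ifs with h
    · simp [hmem r ω h]
    · exact zero_le
  calc ∫⁻ ω, f ω ∂P
      ≤ ∫⁻ ω, (s + t * (S s).indicator 1 ω) + ∑' k : ℕ, (S (t + k)).indicator 1 ω ∂P := by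
        refine lintegral_mono fun ω => ?_
        rcases le_or_gt (f ω) s with h | h
        · exact h.trans (le_self_add.trans le_self_add)
        · refine (le_tsum_indicator_lt (f ω) t).trans
            (add_le_add ?_ (ENNReal.tsum_le_tsum fun k => hone _ ω))
          rw [Set.indicator_of_mem (hmem s ω h)]
          simp
    _ = s + t * P (S s) + ∑' k : ℕ, P (S (t + k)) := by
        have hm : ∀ r, Measurable ((S r).indicator (1 : Ω → ℝ≥0∞)) := fun r =>
          measurable_one.indicator (hS r)
        rw [lintegral_add_left (f := fun ω => s + t * (S s).indicator 1 ω)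
            (measurable_const.add ((hm s).const_mul t)),
          lintegral_add_left measurable_const, lintegral_const_mul _ (hm s),
          lintegral_tsum fun k => (hm _).aemeasurable]
        simp [lintegral_indicator_one (hS _)]
    _ = _ := by simp only [hP]

/-- The condition number is large only if `cos θ(A)` is small. -/
lemma abs_cos_le_of_lt_logCondNumber {m n : ℕ} {A : Matrix (Fin n) (Fin m) ℝ} {t : ℝ}
    (h : ENNReal.ofReal t < logCondNumber A) :
    |Real.cos (maxMinAngle A)| ≤ Real.exp (-t) := by
  by_contra! hlt
  refine absurd h (not_lt.2 ?_)
  have h0 : condNumber A ≤ ENNReal.ofReal (Real.exp t) := by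
    rw [condNumber, ENNReal.inv_le_iff_inv_le, ← ENNReal.ofReal_inv_of_pos (Real.exp_pos t),
      ← Real.exp_neg]
    exact ENNReal.ofReal_le_ofReal hlt.le
  have h1 : ENNReal.log (condNumber A) ≤ (t : EReal) := by
    refine (ENNReal.log_monotone h0).trans (le_of_eq ?_)
    rw [ENNReal.log_ofReal_of_pos (Real.exp_pos t), Real.log_exp]
  exact (EReal.toENNReal_le_toENNReal h1).trans (le_of_eq (EReal.toENNReal_of_ne_top
    (EReal.coe_ne_top t)))

/-- The ratio 5 enters through 8·0.626^5 ≤ 0.95^5. -/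
lemma eight_pow_mul_pow_le {m n : ℕ} (h : 5 * m ≤ n) :
    (8 : ℝ) ^ m * 0.626 ^ n ≤ 0.95 ^ n := by
  obtain ⟨d, rfl⟩ := Nat.exists_eq_add_of_le h
  rw [pow_add, pow_add, pow_mul, pow_mul, ← mul_assoc, ← mul_pow]
  gcongr <;> norm_num

/-- Bernoulli's inequality for 1/0.95 = 1 + 1/19. -/
lemma mul_pow_le (n : ℕ) : (n : ℝ) * 0.95 ^ n ≤ 20 := by
  have h := one_add_mul_le_pow (a := (1 / 19 : ℝ)) (by norm_num) n
  have h1 : (1 + 1 / 19 : ℝ) ^ n * 0.95 ^ n = 1 := by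
    rw [← mul_pow]; norm_num
  have h2 : (0 : ℝ) < 0.95 ^ n := by positivity
  nlinarith

variable {Ω : Type*} [MeasurableSpace Ω] {P : Measure Ω} [IsProbabilityMeasure P] {m n : ℕ}
  {A : Ω → Matrix (Fin n) (Fin m) ℝ}

lemma measure_log_lt_logCondNumber_le (hm : 2 ≤ m) (hmn : 5 * m ≤ n)
    (hA : IsUniformRandomMatrix P A) :
    P {ω | ENNReal.ofReal (Real.log (4000 * m)) < logCondNumber (A ω)} ≤
      ENNReal.ofReal (2 * 0.95 ^ n) := by
  have hm0 : (0 : ℝ) < m := by exact_mod_cast (by omega : 0 < m)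
  -- This ε gives 4mε = 0.001, hence the base 1/8 + 1/2 + 0.001 = 0.626.
  have hε : (0 : ℝ) < (4000 * m : ℝ)⁻¹ := by positivity
  refine le_trans (measure_mono fun ω hω => ?_)
    ((measure_abs_cos_le_pow hm (by omega) hA hε).trans ?_)
  · have := abs_cos_le_of_lt_logCondNumber hω
    rwa [Real.exp_neg, Real.exp_log (by positivity)] at this
  have h1 : 4 * (m : ℝ) * (4000 * m : ℝ)⁻¹ = 0.001 := by field_simp; norm_num
  have h2 : (1 / 8 + (1 / 2 + ENNReal.ofReal 0.001)) = ENNReal.ofReal 0.626 := by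
    have e1 : (1 / 8 : ℝ≥0∞) = ENNReal.ofReal (1 / 8) := by
      rw [ENNReal.ofReal_div_of_pos (by norm_num)]; simp
    have e2 : (1 / 2 : ℝ≥0∞) = ENNReal.ofReal (1 / 2) := by
      rw [ENNReal.ofReal_div_of_pos (by norm_num)]; simp
    rw [e1, e2, ← ENNReal.ofReal_add (by norm_num) (by norm_num),
      ← ENNReal.ofReal_add (by norm_num) (by norm_num)]
    norm_num
  have h3 : (8 : ℝ≥0∞) = ENNReal.ofReal 8 := by simp
  rw [h1, h2, h3, ← ENNReal.ofReal_pow (by norm_num), ← ENNReal.ofReal_pow (by norm_num),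
    ← ENNReal.ofReal_mul (by positivity), ENNReal.ofReal_mul (p := 2) (by norm_num), ENNReal.ofReal_ofNat]
  gcongr
  exact eight_pow_mul_pow_le hmn

lemma measure_add_lt_logCondNumber_le (hm : 2 ≤ m) (hmn : 5 * m ≤ n)
    (hA : IsUniformRandomMatrix P A) (k : ℕ) :
    P {ω | ENNReal.ofReal (4 * n) + k < logCondNumber (A ω)} ≤ 2⁻¹ ^ k := by
  refine le_trans (measure_mono fun ω hω => ?_)
    ((measure_abs_cos_le hm (by omega) hA (Real.exp_pos (-(4 * n + k)))).trans ?_)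
  · apply abs_cos_le_of_lt_logCondNumber
    rwa [ENNReal.ofReal_add (by positivity) (by positivity), ENNReal.ofReal_natCast]
  have hx : (2 : ℝ≥0∞)⁻¹ ^ k = ENNReal.ofReal (2⁻¹ ^ k) := by
    rw [ENNReal.ofReal_pow (by norm_num), ENNReal.ofReal_inv_of_pos (by norm_num)]; simp
  rw [hx]
  apply ENNReal.ofReal_le_ofReal
  have he : (2 : ℝ) ≤ Real.exp 1 := by linarith [Real.add_one_le_exp 1]
  have hexp : Real.exp (-(4 * n + k)) ≤ 2⁻¹ ^ (4 * n + k) := by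
    rw [Real.exp_neg, inv_pow]
    gcongr
    calc (2 : ℝ) ^ (4 * n + k) ≤ Real.exp 1 ^ (4 * n + k) := by gcongr
      _ = _ := by rw [← Real.exp_nat_mul]; push_cast; ring_nf
  have hn2 : (n : ℝ) ≤ 2 ^ n := by exact_mod_cast Nat.lt_two_pow_self.le
  have hmn2 : 2 * (m : ℝ) ≤ n := by exact_mod_cast (by omega : 2 * m ≤ n)
  have hm2 : 4 * (m : ℝ) ^ 2 ≤ 2 ^ n * 2 ^ n := by
    calc 4 * (m : ℝ) ^ 2 = (2 * m) * (2 * m) := by ring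
      _ ≤ _ := by gcongr <;> exact hmn2.trans hn2
  -- The prefactor n·2^n·4m² is at most 2^(4n), which the shift 4n in the exponent absorbs.
  calc (n : ℝ) * 2 ^ n * (4 * m ^ 2 * Real.exp (-(4 * n + k)))
      ≤ 2 ^ n * 2 ^ n * ((2 ^ n * 2 ^ n) * 2⁻¹ ^ (4 * n + k)) := by gcongr
    _ = 2⁻¹ ^ k := by
      have : (2 : ℝ) ^ n * 2⁻¹ ^ n = 1 := by rw [← mul_pow]; norm_num
      calc (2 : ℝ) ^ n * 2 ^ n * ((2 ^ n * 2 ^ n) * 2⁻¹ ^ (4 * n + k))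
          = (2 ^ n * 2⁻¹ ^ n) ^ 4 * 2⁻¹ ^ k := by ring
        _ = _ := by rw [this]; simp

/-- The expected logarithm of the condition number is at most `log m + O(1)`. -/
lemma lintegral_logCondNumber_le (hm : 2 ≤ m) (hmn : 5 * m ≤ n)
    (hA : IsUniformRandomMatrix P A) :
    ∫⁻ ω, logCondNumber (A ω) ∂P ≤ ENNReal.ofReal (Real.log (4000 * m) + 162) := by
  have hlog : 0 ≤ Real.log (4000 * m) := by
    apply Real.log_nonneg
    have : (2 : ℝ) ≤ m := by exact_mod_cast hm
    linarith
  refine (lintegral_le_add_tsum_measure _ (ENNReal.ofReal (Real.log (4000 * m)))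
    (ENNReal.ofReal (4 * n))).trans ?_
  -- 4n·2·0.95^n ≤ 8·20 = 160; the geometric series adds 2, whence 162.
  have h1 : ENNReal.ofReal (4 * n) *
      P {ω | ENNReal.ofReal (Real.log (4000 * m)) < logCondNumber (A ω)} ≤
      ENNReal.ofReal 160 := by
    refine (mul_le_mul_right (measure_log_lt_logCondNumber_le hm hmn hA) _).trans ?_
    rw [← ENNReal.ofReal_mul (by positivity)]
    apply ENNReal.ofReal_le_ofReal
    linarith [mul_pow_le n]
  have h2 : ∑' k : ℕ, P {ω | ENNReal.ofReal (4 * n) + k < logCondNumber (A ω)} ≤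
      ENNReal.ofReal 2 := by
    refine (ENNReal.tsum_le_tsum fun k => measure_add_lt_logCondNumber_le hm hmn hA k).trans ?_
    rw [ENNReal.tsum_geometric, ENNReal.one_sub_inv_two, inv_inv]
    simp
  refine (add_le_add (add_le_add_right h1 _) h2).trans (le_of_eq ?_)
  rw [← ENNReal.ofReal_add hlog (by norm_num), ← ENNReal.ofReal_add (by positivity) (by norm_num)]
  congr 1
  ring

end

end LPCondition

/-! ### The limit in m -/

theorem mainTheorem5 {Ω : ℕ → ℕ → Type*} [∀ m n, MeasurableSpace (Ω m n)]
    (P : ∀ m n, Measure (Ω m n)) [∀ m n, IsProbabilityMeasure (P m n)]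
    (A : ∀ m n, Ω m n → Matrix (Fin n) (Fin m) ℝ)
    (hA : ∀ m n, 1 ≤ m → m ≤ n → LPCondition.IsUniformRandomMatrix (P m n) (A m n))
    (γ : ℝ) (hγ : 0 < γ) :
    limsup (fun m : ℕ => ⨆ n : ℕ, ⨆ _ : 5 * m ≤ n,
      (∫⁻ ω, LPCondition.logCondNumber (A m n ω) ∂(P m n)) / (m : ℝ≥0∞) ^ γ) atTop = 0 := by
  refine Tendsto.limsup_eq ?_
  have hlim : Tendsto (fun m : ℕ => ENNReal.ofReal ((Real.log (4000 * m) + 162) / (m : ℝ) ^ γ))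
      atTop (nhds 0) := by
    have h : Tendsto (fun x : ℝ => (Real.log (4000 * x) + 162) / x ^ γ) atTop (nhds 0) := by
      have h1 := (isLittleO_log_rpow_atTop hγ).tendsto_div_nhds_zero
      have h2 := (tendsto_rpow_neg_atTop hγ).const_mul (Real.log 4000 + 162)
      have h3 := h1.add h2
      rw [mul_zero, add_zero] at h3
      refine h3.congr' ?_
      filter_upwards [eventually_gt_atTop 0] with x hx
      rw [Real.log_mul (by norm_num) hx.ne', Real.rpow_neg hx.le]
      field_simp
      ring
    simpa using ENNReal.tendsto_ofReal (h.comp tendsto_natCast_atTop_atTop)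
  refine tendsto_of_tendsto_of_tendsto_of_le_of_le' tendsto_const_nhds hlim
    (Eventually.of_forall fun _ => zero_le) ?_
  -- The slab estimate compares with the ball of dimension m - 1 ≥ 1, so m = 1 is left out.
  filter_upwards [eventually_ge_atTop 2] with m hm
  refine iSup₂_le fun n hn => ?_
  have hm0 : (0 : ℝ) < m := by exact_mod_cast (by omega : 0 < m)
  rw [ENNReal.ofReal_div_of_pos (by positivity), ← ENNReal.ofReal_rpow_of_pos hm0,
    ENNReal.ofReal_natCast]
  gcongr
  exact LPCondition.lintegral_logCondNumber_le hm hn (hA m n (by omega) (by omega))
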